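/- Logarithms are to base $2$. Let $\mathcal X$ be a set, $\mathcal Y$ a finite non-empty set with $k=|\mathcal Y|$, and $\mathcal H\subseteq\mathcal Y^{\mathcal X}$. *The game.* In transductive online learning of length $n$, a sequence $x=(x_1,\dots,x_n)\in\mathcal X^n$ is fixed and shown to the learner in advance; in round $t=1,\dots,n$ the learner, who knows $x$ and the labels $h(x_1),\dots,h(x_{t-1})$, predicts $\hat y_t\in\mathcal Y$, and then $h(x_t)$ is revealed, where $h\in\mathcal H$ is unknown to the learner. For a deterministic learner strategy $A$ let $M(A,x,h)=|\{t:\hat y_t\neq h(x_t)\}|$, and let $$M(\mathcal H,n)=\inf_A\ \sup_{x\in\mathcal X^n}\ \sup_{h\in\mathcal H}\ M(A,x,h).$$ *Dimensions.* $\mathcal H$ Natarajan-shatters a finite set $S\subseteq\mathcal X$ if there are $f_0,f_1:S\to\mathcal Y$ with $f_0(x)\ne f_1(x)$ for all $x\in S$ such that for every $A\subseteq S$ some $h\in\mathcal H$ satisfies $h(x)=f_1(x)$ for $x\in A$ and $h(x)=f_0(x)$ for $x\in S\setminus A$. The Natarajan dimension $\mathsf{ND}(\mathcal H)$ is the supremum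 of $|S|$ over all such $S$. A Littlestone tree of depth $d$ assigns to each $u\in\bigcup_{s=0}^{d}\{0,1\}^s$ an instance $x_u\in\mathcal X$ and two labels $y_{u0}\ne y_{u1}$ in $\mathcal Y$; it is shattered by $\mathcal H$ if for every $u\in\{0,1\}^{d+1}$ there is $h\in\mathcal H$ with $h(x_{u_{\le i-1}})=y_{u_{\le i}}$ for $i=1,\dots,d+1$, where $u_{\le i}$ is the prefix of $u$ of length $i$. The Littlestone dimension $\mathsf{LD}(\mathcal H)$ is the supremum of all $d\in\{0,1,2,\dots\}$ for which a tree of depth $d$ is shattered. (The supremum of the empty set is $0$.) **Theorem.** There is a universal constant $C>0$, not depending on $\mathcal X$, $\mathcal Y$ or $\mathcal H$, such that for all $\mathcal X,\mathcal Y,\mathcal H$ as above: 1. If $\mathsf{ND}(\mathcal H)=\infty$, then $M(\mathcal H,n)=n$ for every integer $0\le n\le|\mathcal X|$. 2. If $\mathsf{ND}(\mathcal H)=d<\infty$ and $\mathsf{LD}(\mathcal H)=\infty$, then for every integer $1\le n\le|\mathcal X|$ $$\max\{\min\{d,n\},\lfloor\log n\rfloor\}\le M(\mathcal H,n),$$ and,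 whenever $nk\ge 2d$ (in particular whenever $n\ge d$), $$M(\mathcal H,n)\le C\,d\,\log\!\left(\frac{nk}{d}\right).$$ 3. If $\mathsf{LD}(\mathcal H)<\infty$, then there is a number $C(\mathcal H)\in\mathbb N$, depending on $\mathcal X,\mathcal Y,\mathcal H$ but not on $n$, such that $M(\mathcal H,n)\le C(\mathcal H)$ for every integer $0\le n\le|\mathcal X|$. -/

import Mathlib

namespace TransductiveOnline

universe u v

variable {X : Type u} {Y : Type v}

/-- A deterministic learner strategy for games of length `n`. The whole sequence of instances
`x` is known in advance; at (zero-based) round `t` the learner also knows the `t` labels revealed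
so far and returns a prediction. -/
def Strategy (X : Type u) (Y : Type v) (n : ℕ) : Type (max u v) :=
  (Fin n → X) → (t : Fin n) → (Fin (t : ℕ) → Y) → Y

/-- The prediction of the strategy `A` at round `t` when the instances are `x` and all labels
revealed so far are those of `h`. -/
def Strategy.prediction {n : ℕ} (A : Strategy X Y n) (x : Fin n → X) (h : X → Y) (t : Fin n) : Y :=
  A x t (fun i => h (x ⟨i, i.isLt.trans t.isLt⟩))

/-- The number of mistakes `M(A, x, h) = |{t : ŷ_t ≠ h(x_t)}|`. -/
noncomputable def Strategy.mistakes {n : ℕ} (A : Strategy X Y n) (x : Fin n → X) (h : X → Y) : ℕ :=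
  {t : Fin n | A.prediction x h t ≠ h (x t)}.ncard

/-- The value of the game, `M(H, n) = inf_A sup_x sup_{h ∈ H} M(A, x, h)`. -/
noncomputable def gameValue (H : Set (X → Y)) (n : ℕ) : ℕ∞ :=
  ⨅ A : Strategy X Y n, ⨆ x : Fin n → X, ⨆ h ∈ H, (A.mistakes x h : ℕ∞)

/-- `H` Natarajan-shatters the finite set `S`. -/
def NatarajanShatters (H : Set (X → Y)) (S : Finset X) : Prop :=
  ∃ f₀ f₁ : S → Y, (∀ x, f₀ x ≠ f₁ x) ∧
    ∀ A : Finset X, A ⊆ S → ∃ h ∈ H, ∀ x : S,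
      ((x : X) ∈ A → h x = f₁ x) ∧ ((x : X) ∉ A → h x = f₀ x)

/-- The Natarajan dimension. -/
noncomputable def natarajanDim (H : Set (X → Y)) : ℕ∞ :=
  ⨆ (S : Finset X) (_ : NatarajanShatters H S), (S.card : ℕ∞)

/-- A multiclass Littlestone tree of depth `d`. The nodes are the bit strings `u` of length at
most `d` (so there are `d + 1` levels); `node u` is the instance at `u`, and `label (u ++ [b])` is
the label of the edge leaving `u` in direction `b`. Values of `node` at strings longer than `d`, and
of `label` at `[]` and at strings longer than `d + 1`, play no role. -/
structure LittlestoneTree (X : Type u) (Y : Type v) (d : ℕ) where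
  node : List Bool → X
  label : List Bool → Y
  label_ne : ∀ u : List Bool, u.length ≤ d → label (u ++ [false]) ≠ label (u ++ [true])

/-- `H` shatters the tree: every branch `u ∈ {0,1}^(d+1)` is realized by some `h ∈ H`. -/
def LittlestoneTree.ShatteredBy {d : ℕ} (T : LittlestoneTree X Y d) (H : Set (X → Y)) : Prop :=
  ∀ u : List Bool, u.length = d + 1 →
    ∃ h ∈ H, ∀ i < d + 1, h (T.node (u.take i)) = T.label (u.take (i + 1))

/-- The multiclass Littlestone dimension. -/
noncomputable def littlestoneDim (H : Set (X → Y)) : ℕ∞ :=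
  ⨆ (d : ℕ) (_ : ∃ T : LittlestoneTree X Y d, T.ShatteredBy H), (d : ℕ∞)

end TransductiveOnline

namespace TransductiveOnline

universe u v

section

open Finset

variable {X : Type u} {Y : Type v}

/-! Lower bounds come from an adversary who keeps a class of still-consistent functions. On a
shattered set both labels stay possible at each point, so every prediction can be contradicted. For
the logarithmic bound, infinite Littlestone dimension gives mistake trees of every depth, but the
instances are announced before any label is. One sequence must therefore serve all `2 ^ m - 1` nodes
of a depth-`m` tree, including nodes off the branch eventually taken. `exists_list_forces` builds
it: a pigeonhole over the `k` labels (`Branching.exists_fiber`) keeps a `1 / k` share of the depth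
of each class not being split, and a deep enough initial tree pays for all these losses.

Upper bounds come from `gameValue_le_of_potential`: if two different labels cannot both preserve a
potential, predicting the label that preserves it makes every mistake lower it. Mistake-tree depth
bounds the game when the Littlestone dimension is finite. The base-2 logarithm of the number of
restrictions to the announced instances does so when the Natarajan dimension `d` is finite:
`card_le_sauerSum` bounds that number by the sum of `n.choose i * k ^ (2 * i)` over `i ≤ d`, whose
logarithm is `O(d log (n k / d))` for `1 ≤ d ≤ n` and `k ≥ 2`. For `n < d` the trivial bound `n`
suffices. -/

/-- The functions of `V` that take the value `y` at `x`. -/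
def fiber (V : Set (X → Y)) (x : X) (y : Y) : Set (X → Y) := {h ∈ V | h x = y}

theorem fiber_subset (V : Set (X → Y)) (x : X) (y : Y) : fiber V x y ⊆ V := fun _ h => h.1

theorem fiber_mono {V W : Set (X → Y)} (hVW : V ⊆ W) (x : X) (y : Y) :
    fiber V x y ⊆ fiber W x y := fun _ h => ⟨hVW h.1, h.2⟩

/-! ### Forcing mistakes -/

/-- On the instance list `xs` an adversary restricted to `V` can force at least `m` mistakes. -/
def Forces : List X → Set (X → Y) → ℕ → Prop
  | [], V, m => V.Nonempty ∧ m = 0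
  | x :: xs, V, m => ∀ p : Y, ∃ y : Y,
      Forces xs (fiber V x y) m ∨ p ≠ y ∧ ∃ m', m = m' + 1 ∧ Forces xs (fiber V x y) m'

theorem Forces.nonempty [Nonempty Y] :
    ∀ {xs : List X} {V : Set (X → Y)} {m : ℕ}, Forces xs V m → V.Nonempty
  | [], _, _, h => h.1
  | x :: xs, V, m, h => by
    obtain ⟨y, h | ⟨-, m', -, h⟩⟩ := h (Classical.arbitrary Y)
    · exact h.nonempty.mono (fiber_subset _ _ _)
    · exact h.nonempty.mono (fiber_subset _ _ _)

theorem forces_zero : ∀ (xs : List X) {V : Set (X → Y)}, V.Nonempty → Forces xs V 0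
  | [], _, h => ⟨h, rfl⟩
  | x :: xs, _, ⟨g, hg⟩ => fun _ => ⟨g x, Or.inl (forces_zero xs ⟨g, hg, rfl⟩)⟩

/-- Padding costs the adversary nothing: once the mistakes are forced, any surviving function labels
the remaining instances. -/
theorem Forces.append (ys : List X) :
    ∀ {xs : List X} {V : Set (X → Y)} {m : ℕ}, Forces xs V m → Forces (xs ++ ys) V m
  | [], _, _, ⟨h, hm⟩ => hm ▸ forces_zero ys h
  | x :: xs, V, m, h => fun p => by
    obtain ⟨y, h | ⟨hp, m', hm, h⟩⟩ := h p
    · exact ⟨y, Or.inl (h.append ys)⟩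
    · exact ⟨y, Or.inr ⟨hp, m', hm, h.append ys⟩⟩

theorem Forces.mono : ∀ {xs : List X} {V W : Set (X → Y)} {m : ℕ}, V ⊆ W →
    Forces xs V m → Forces xs W m
  | [], _, _, _, hVW, ⟨h, hm⟩ => ⟨h.mono hVW, hm⟩
  | x :: xs, V, W, m, hVW, h => fun p => by
    obtain ⟨y, h | ⟨hp, m', hm, h⟩⟩ := h p
    · exact ⟨y, Or.inl (h.mono (fiber_mono hVW x y))⟩
    · exact ⟨y, Or.inr ⟨hp, m', hm, h.mono (fiber_mono hVW x y)⟩⟩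

theorem Strategy.prediction_congr {n : ℕ} (A : Strategy X Y n) (x : Fin n → X) {g h : X → Y}
    (t : Fin n) (hgh : ∀ i < t, g (x i) = h (x i)) : A.prediction x g t = A.prediction x h t := by
  unfold Strategy.prediction
  congr 1
  funext i
  exact hgh _ i.isLt

-- All members of `V` agree on the rounds before `t`, so the learner's prediction at round `t` is
-- the same for each of them. The adversary can thus answer it before committing to a function.
open Classical in
theorem Forces.exists_mistakes_from [Nonempty Y] {n : ℕ} (A : Strategy X Y n) (x : Fin n → X) :
    ∀ (s t : ℕ), t + s = n → ∀ (V : Set (X → Y)) (m : ℕ),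
      (∀ g ∈ V, ∀ h ∈ V, ∀ i : Fin n, (i : ℕ) < t → g (x i) = h (x i)) →
      Forces ((List.ofFn x).drop t) V m →
      ∃ h ∈ V, m ≤ #{i : Fin n | t ≤ i ∧ A.prediction x h i ≠ h (x i)} := by
  intro s
  induction s with
  | zero =>
    intro t ht V m _ hF
    rw [List.drop_of_length_le (by simp; omega)] at hF
    obtain ⟨⟨h, hh⟩, rfl⟩ := hF
    exact ⟨h, hh, Nat.zero_le _⟩
  | succ s ih =>
    intro t ht V m hV hF
    have htn : t < n := by omega
    obtain ⟨g, hg⟩ := hF.nonempty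
    rw [List.drop_eq_getElem_cons (by simpa using htn), List.getElem_ofFn] at hF
    obtain ⟨y, hy⟩ := hF (A.prediction x g ⟨t, htn⟩)
    have hagree : ∀ g ∈ fiber V (x ⟨t, htn⟩) y, ∀ h ∈ fiber V (x ⟨t, htn⟩) y, ∀ i : Fin n,
        (i : ℕ) < t + 1 → g (x i) = h (x i) := by
      intro g hg h hh i hi
      rcases Nat.lt_succ_iff_lt_or_eq.mp hi with hi | hi
      · exact hV g hg.1 h hh.1 i hi
      · obtain rfl : i = ⟨t, htn⟩ := Fin.ext hi
        exact hg.2.trans hh.2.symm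
    rcases hy with hy | ⟨hp, m', rfl, hy⟩
    · obtain ⟨h, hh, hm⟩ := ih (t + 1) (by omega) _ _ hagree hy
      refine ⟨h, hh.1, hm.trans (card_le_card ?_)⟩
      intro i
      simp only [mem_filter, mem_univ, true_and]
      exact fun hi => ⟨by omega, hi.2⟩
    · obtain ⟨h, hh, hm⟩ := ih (t + 1) (by omega) _ _ hagree hy
      refine ⟨h, hh.1, ?_⟩
      have hnot : (⟨t, htn⟩ : Fin n) ∉
          ({i : Fin n | t + 1 ≤ i ∧ A.prediction x h i ≠ h (x i)} : Finset (Fin n)) := by simp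
      refine (Nat.succ_le_succ hm).trans ?_
      rw [Nat.succ_eq_add_one, ← card_insert_of_notMem hnot]
      refine card_le_card fun i => ?_
      simp only [mem_insert, mem_filter, mem_univ, true_and]
      rintro (rfl | hi)
      · refine ⟨le_rfl, ?_⟩
        rw [A.prediction_congr x ⟨t, htn⟩ (fun i hi => hV h hh.1 g hg i hi), hh.2]
        exact hp
      · exact ⟨by omega, hi.2⟩

theorem Forces.le_gameValue [Nonempty Y] {xs : List X} {H : Set (X → Y)} {m : ℕ}
    (hF : Forces xs H m) : (m : ℕ∞) ≤ gameValue H xs.length := by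
  classical
  refine le_iInf fun A => ?_
  obtain ⟨h, hh, hm⟩ := Forces.exists_mistakes_from A xs.get xs.length 0 (by simp) H m
    (by simp) (by simpa using hF)
  refine le_trans ?_ (le_iSup_of_le xs.get (le_iSup₂_of_le h hh le_rfl))
  rw [Strategy.mistakes, Set.ncard_eq_toFinset_card']
  simpa using hm

/-! ### Natarajan shattering -/

theorem NatarajanShatters.exists_total [Nonempty Y] {H : Set (X → Y)} {S : Finset X}
    (hS : NatarajanShatters H S) : ∃ f₀ f₁ : X → Y, (∀ x ∈ S, f₀ x ≠ f₁ x) ∧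
      ∀ A : Finset X, A ⊆ S → ∃ h ∈ H, ∀ x ∈ S, (x ∈ A → h x = f₁ x) ∧ (x ∉ A → h x = f₀ x) := by
  classical
  obtain ⟨f₀, f₁, hne, hA⟩ := hS
  refine ⟨fun x => if hx : x ∈ S then f₀ ⟨x, hx⟩ else Classical.arbitrary Y,
    fun x => if hx : x ∈ S then f₁ ⟨x, hx⟩ else Classical.arbitrary Y, ?_, ?_⟩
  · intro x hx
    simpa [hx] using hne ⟨x, hx⟩
  · intro A hAS
    obtain ⟨h, hh, hx⟩ := hA A hAS
    refine ⟨h, hh, fun x hxS => ?_⟩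
    simpa [hxS] using hx ⟨x, hxS⟩

theorem NatarajanShatters.of_total {H : Set (X → Y)} {S : Finset X} (f₀ f₁ : X → Y)
    (hne : ∀ x ∈ S, f₀ x ≠ f₁ x)
    (hA : ∀ A : Finset X, A ⊆ S →
      ∃ h ∈ H, ∀ x ∈ S, (x ∈ A → h x = f₁ x) ∧ (x ∉ A → h x = f₀ x)) :
    NatarajanShatters H S := by
  refine ⟨fun x => f₀ x, fun x => f₁ x, fun x => hne x x.2, fun A hAS => ?_⟩
  obtain ⟨h, hh, hx⟩ := hA A hAS
  exact ⟨h, hh, fun x => hx x x.2⟩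

theorem natarajanShatters_empty {H : Set (X → Y)} (hH : H.Nonempty) : NatarajanShatters H ∅ := by
  obtain ⟨h, hh⟩ := hH
  exact .of_total h h (by simp) fun A _ => ⟨h, hh, by simp⟩

theorem NatarajanShatters.exists_ne {H : Set (X → Y)} {S : Finset X} (hS : NatarajanShatters H S)
    {x : X} (hx : x ∈ S) : ∃ g ∈ H, ∃ h ∈ H, g x ≠ h x := by
  obtain ⟨f₀, f₁, hne, hA⟩ := hS
  obtain ⟨g, hg, hgx⟩ := hA ∅ (by simp)
  obtain ⟨h, hh, hhx⟩ := hA S le_rfl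
  refine ⟨g, hg, h, hh, ?_⟩
  rw [(hgx ⟨x, hx⟩).2 (by simp), (hhx ⟨x, hx⟩).1 hx]
  exact hne _

theorem exists_natarajanShatters_of_lt {H : Set (X → Y)} {m : ℕ}
    (hm : (m : ℕ∞) < natarajanDim H) : ∃ S, NatarajanShatters H S ∧ m < S.card := by
  obtain ⟨S, hS⟩ := lt_iSup_iff.mp hm
  obtain ⟨hS, hlt⟩ := lt_iSup_iff.mp hS
  exact ⟨S, hS, by exact_mod_cast hlt⟩

theorem forces_length_of_shattered {f₀ f₁ : X → Y} :
    ∀ (l : List X) (V : Set (X → Y)), l.Nodup → (∀ x ∈ l, f₀ x ≠ f₁ x) →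
      (∀ A : Set X, ∃ h ∈ V, ∀ x ∈ l, (x ∈ A → h x = f₁ x) ∧ (x ∉ A → h x = f₀ x)) →
      Forces l V l.length
  | [], V, _, _, hA => by
    obtain ⟨h, hh, -⟩ := hA ∅
    exact ⟨⟨h, hh⟩, rfl⟩
  | a :: l, V, hl, hne, hA => by
    intro p
    rw [List.nodup_cons] at hl
    have key : ∀ y, (y = f₀ a ∨ y = f₁ a) → Forces l (fiber V a y) l.length := by
      intro y hy
      refine forces_length_of_shattered l _ hl.2 (fun x hx => hne x (List.mem_cons_of_mem _ hx)) ?_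
      intro A
      rcases hy with rfl | rfl
      -- Removing `a` from the pattern, or inserting it, fixes the label at `a` and leaves the
      -- pattern on `l` free.
      · obtain ⟨h, hh, hx⟩ := hA (A \ {a})
        refine ⟨h, ⟨hh, (hx a (by simp)).2 (by simp)⟩, fun x hxl => ?_⟩
        have hxa : x ≠ a := fun e => hl.1 (e ▸ hxl)
        simpa [hxa] using hx x (List.mem_cons_of_mem _ hxl)
      · obtain ⟨h, hh, hx⟩ := hA (insert a A)
        refine ⟨h, ⟨hh, (hx a (by simp)).1 (by simp)⟩, fun x hxl => ?_⟩
        have hxa : x ≠ a := fun e => hl.1 (e ▸ hxl)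
        simpa [hxa] using hx x (List.mem_cons_of_mem _ hxl)
    by_cases hp : p = f₀ a
    · exact ⟨f₁ a, Or.inr ⟨hp ▸ hne a (by simp), _, rfl, key _ (Or.inr rfl)⟩⟩
    · exact ⟨f₀ a, Or.inr ⟨hp, _, rfl, key _ (Or.inl rfl)⟩⟩

theorem le_gameValue_of_le_natarajanDim [Nonempty Y] {H : Set (X → Y)} {m n : ℕ}
    (hm : (m : ℕ∞) ≤ natarajanDim H) (hmn : m ≤ n) : (m : ℕ∞) ≤ gameValue H n := by
  classical
  rcases m with _ | m
  · simp
  obtain ⟨S, hS, hcard⟩ := exists_natarajanShatters_of_lt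
    (lt_of_lt_of_le (by exact_mod_cast Nat.lt_succ_self m) hm)
  obtain ⟨T, hTS, hT⟩ := Finset.exists_subset_card_eq (Nat.succ_le_of_lt hcard)
  obtain ⟨f₀, f₁, hne, hA⟩ := hS.exists_total
  have hF : Forces T.toList H T.toList.length := by
    refine forces_length_of_shattered (f₀ := f₀) (f₁ := f₁) _ _ T.nodup_toList
      (fun x hx => hne x (hTS (by simpa using hx))) fun A => ?_
    obtain ⟨h, hh, hx⟩ := hA {x ∈ S | x ∈ A} (filter_subset _ _)
    refine ⟨h, hh, fun x hxT => ?_⟩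
    have hxS := hTS (by simpa using hxT)
    simpa [hxS] using hx x hxS
  obtain ⟨a, -⟩ : T.Nonempty := by rw [← card_pos]; omega
  -- The shattered set supplies only `m + 1` rounds; repetitions of one of its points fill the rest.
  have := (hF.append (List.replicate (n - (m + 1)) a)).le_gameValue
  simpa [hT, Nat.add_sub_cancel' hmn] using this

/-! ### Branching and the Littlestone dimension -/

/-- `V` shatters a complete binary mistake tree with `m` levels of internal nodes. -/
def Branching : ℕ → Set (X → Y) → Prop
  | 0, V => V.Nonempty
  | m + 1, V => ∃ (x : X) (y₀ y₁ : Y), y₀ ≠ y₁ ∧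
      Branching m (fiber V x y₀) ∧ Branching m (fiber V x y₁)

theorem Branching.mono : ∀ {m : ℕ} {V W : Set (X → Y)}, V ⊆ W → Branching m V → Branching m W
  | 0, _, _, hVW, h => Set.Nonempty.mono hVW h
  | _ + 1, _, _, hVW, ⟨x, y₀, y₁, hne, h₀, h₁⟩ =>
    ⟨x, y₀, y₁, hne, h₀.mono (fiber_mono hVW _ _), h₁.mono (fiber_mono hVW _ _)⟩

theorem Branching.nonempty : ∀ {m : ℕ} {V : Set (X → Y)}, Branching m V → V.Nonempty
  | 0, _, h => h
  | _ + 1, _, ⟨_, _, _, _, h, _⟩ => h.nonempty.mono (fiber_subset _ _ _)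

theorem Branching.pred : ∀ {m : ℕ} {V : Set (X → Y)}, Branching (m + 1) V → Branching m V
  | _, _, ⟨_, _, _, _, h, _⟩ => h.mono (fiber_subset _ _ _)

theorem Branching.of_le {m m' : ℕ} {V : Set (X → Y)} (hm : m ≤ m') (h : Branching m' V) :
    Branching m V := by
  induction hm with
  | refl => exact h
  | step _ ih => exact ih h.pred

theorem fiber_inter (V P : Set (X → Y)) (x : X) (y : Y) : fiber (V ∩ P) x y = fiber V x y ∩ P := by
  ext h
  simp only [fiber, Set.mem_inter_iff, Set.mem_ofPred_eq]
  tauto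

/-- A Ramsey property of trees, by induction on `a`: if a child already yields depth `b` outside
`P`, that is enough; otherwise both children yield depth `a` inside `P`, and the root joins them. -/
theorem Branching.inter_or_diff (P : Set (X → Y)) (b : ℕ) :
    ∀ {a : ℕ} {V : Set (X → Y)}, Branching (a + b) V →
      Branching a (V ∩ P) ∨ Branching b (V ∩ Pᶜ)
  | 0, V, h => by
    by_cases hP : (V ∩ P).Nonempty
    · exact Or.inl hP
    · refine Or.inr ?_
      rw [zero_add] at h
      exact h.mono fun g hg => ⟨hg, fun hgP => hP ⟨g, hg, hgP⟩⟩
  | a + 1, V, h => by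
    rw [Nat.add_right_comm] at h
    obtain ⟨x, y₀, y₁, hne, h₀, h₁⟩ := h
    rcases h₀.inter_or_diff P b with h₀ | h₀
    · rcases h₁.inter_or_diff P b with h₁ | h₁
      · rw [← fiber_inter] at h₀ h₁
        exact Or.inl ⟨x, y₀, y₁, hne, h₀, h₁⟩
      · exact Or.inr (h₁.mono (Set.inter_subset_inter_left _ (fiber_subset _ _ _)))
    · exact Or.inr (h₀.mono (Set.inter_subset_inter_left _ (fiber_subset _ _ _)))

/-- The values in `F` are split off one at a time, each at the price of `M` levels. They cannot all
fail, since a class with no value left at `x` is empty. -/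
theorem Branching.exists_fiber_of_mem (x : X) (M : ℕ) (F : Finset Y) :
    ∀ {V : Set (X → Y)}, (∀ h ∈ V, h x ∈ F) → Branching (F.card * M) V →
      ∃ y, Branching M (fiber V x y) := by
  classical
  induction F using Finset.induction_on with
  | empty =>
    intro V hV h
    obtain ⟨g, hg⟩ := h.nonempty
    simpa using hV g hg
  | insert y F hy ih =>
    intro V hV h
    rw [card_insert_of_notMem hy, Nat.succ_mul, add_comm] at h
    rcases h.inter_or_diff {h | h x = y} with h | h
    · exact ⟨y, h⟩
    · obtain ⟨z, hz⟩ := ih (fun g hg => (mem_insert.mp (hV g hg.1)).resolve_left hg.2) h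
      exact ⟨z, hz.mono (fiber_mono Set.inter_subset_left _ _)⟩

theorem Branching.exists_fiber [Finite Y] (x : X) {M : ℕ} {V : Set (X → Y)}
    (h : Branching (Nat.card Y * M) V) : ∃ y, Branching M (fiber V x y) := by
  have := Fintype.ofFinite Y
  rw [Nat.card_eq_fintype_card] at h
  exact Branching.exists_fiber_of_mem x M univ (by simp) h

theorem Branching.of_tree : ∀ (m : ℕ) (V : Set (X → Y)) (node : List Bool → X)
    (label : List Bool → Y),
    (∀ u : List Bool, u.length < m → label (u ++ [false]) ≠ label (u ++ [true])) →
    (∀ u : List Bool, u.length = m →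
      ∃ h ∈ V, ∀ i < m, h (node (u.take i)) = label (u.take (i + 1))) → Branching m V
  | 0, V, _, _, _, h => by
    obtain ⟨g, hg, -⟩ := h [] rfl
    exact ⟨g, hg⟩
  | m + 1, V, node, label, hne, h => by
    have key : ∀ b, Branching m (fiber V (node []) (label [b])) := by
      intro b
      refine Branching.of_tree m _ (fun u => node (b :: u)) (fun u => label (b :: u))
        (fun u hu => hne (b :: u) (by simpa using hu)) fun u hu => ?_
      obtain ⟨g, hg, hi⟩ := h (b :: u) (by simpa using hu)
      exact ⟨g, ⟨hg, by simpa using hi 0 (by omega)⟩, fun i hi' => hi (i + 1) (by omega)⟩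
    exact ⟨node [], label [false], label [true], hne [] (by simp), key _, key _⟩

theorem Branching.exists_tree [Nonempty X] [Nonempty Y] : ∀ (m : ℕ) (V : Set (X → Y)),
    Branching m V → ∃ (node : List Bool → X) (label : List Bool → Y),
      (∀ u : List Bool, u.length < m → label (u ++ [false]) ≠ label (u ++ [true])) ∧
      (∀ u : List Bool, u.length = m →
        ∃ h ∈ V, ∀ i < m, h (node (u.take i)) = label (u.take (i + 1)))
  | 0, V, ⟨g, hg⟩ =>
    ⟨fun _ => Classical.arbitrary X, fun _ => Classical.arbitrary Y, by simp,
      fun _ _ => ⟨g, hg, by simp⟩⟩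
  | m + 1, V, ⟨x, y₀, y₁, hne, h₀, h₁⟩ => by
    obtain ⟨node₀, label₀, hne₀, hs₀⟩ := Branching.exists_tree m _ h₀
    obtain ⟨node₁, label₁, hne₁, hs₁⟩ := Branching.exists_tree m _ h₁
    -- The first bit selects the subtree. Strings of one bit carry the labels at the root, and the
    -- label of `[]` is a dummy.
    refine ⟨fun u => match u with
      | [] => x
      | false :: u => node₀ u
      | true :: u => node₁ u, fun u => match u with
      | [] => y₀
      | [false] => y₀
      | [true] => y₁
      | false :: c :: u => label₀ (c :: u)
      | true :: c :: u => label₁ (c :: u), ?_, ?_⟩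
    · rintro (_ | ⟨b, _ | ⟨c, u⟩⟩) hu
      · exact hne
      · cases b
        · exact hne₀ [] (by simpa using hu)
        · exact hne₁ [] (by simpa using hu)
      · cases b
        · exact hne₀ (c :: u) (by simpa using hu)
        · exact hne₁ (c :: u) (by simpa using hu)
    · rintro (_ | ⟨b, u⟩) hu
      · simp at hu
      · have hu' : u.length = m := by simpa using hu
        cases b
        · obtain ⟨g, hg, hi⟩ := hs₀ u hu'
          refine ⟨g, hg.1, fun i him => ?_⟩
          rcases i with _ | i
          · exact hg.2
          · have := hi i (by omega)
            -- The glued labels reduce only when a second bit is visible; `u = []` would give `m =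
            -- 0`, contrary to `i < m`.
            rcases u with _ | ⟨c, u⟩
            · simp at hu'; omega
            · exact this
        · obtain ⟨g, hg, hi⟩ := hs₁ u hu'
          refine ⟨g, hg.1, fun i him => ?_⟩
          rcases i with _ | i
          · exact hg.2
          · have := hi i (by omega)
            rcases u with _ | ⟨c, u⟩
            · simp at hu'; omega
            · exact this

theorem branching_of_littlestoneDim_eq_top {H : Set (X → Y)} (hH : littlestoneDim H = ⊤) (m : ℕ) :
    Branching m H := by
  have hm : (m : ℕ∞) < littlestoneDim H := hH ▸ ENat.natCast_lt_top m
  obtain ⟨d, hd⟩ := lt_iSup_iff.mp hm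
  obtain ⟨⟨T, hT⟩, hlt⟩ := lt_iSup_iff.mp hd
  have hmd : m < d := by exact_mod_cast hlt
  exact (Branching.of_tree (d + 1) H T.node T.label
    (fun u hu => T.label_ne u (by omega)) hT).of_le (by omega)

/-- The shift by one arises because a Littlestone tree of depth `d` has `d + 1` levels of instances.
-/
theorem Branching.le_littlestoneDim [Nonempty Y] {H : Set (X → Y)} {d : ℕ}
    (h : Branching (d + 1) H) : (d : ℕ∞) ≤ littlestoneDim H := by
  have : Nonempty X := ⟨h.choose⟩
  obtain ⟨node, label, hne, hs⟩ := Branching.exists_tree _ _ h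
  exact le_iSup₂_of_le d
    ⟨⟨node, label, fun u hu => hne u (Nat.lt_succ_of_le hu)⟩, hs⟩ le_rfl

theorem natarajanDim_pos_of_branching {H : Set (X → Y)} (h : Branching 1 H) :
    0 < natarajanDim H := by
  classical
  obtain ⟨x, y₀, y₁, hne, ⟨g₀, hg₀, h₀⟩, ⟨g₁, hg₁, h₁⟩⟩ := h
  have hS : NatarajanShatters H {x} := by
    refine .of_total g₀ g₁ (by simpa [h₀, h₁] using hne) fun A _ => ?_
    by_cases hx : x ∈ A
    · exact ⟨g₁, hg₁, by simp [hx]⟩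
    · exact ⟨g₀, hg₀, by simp [hx]⟩
  exact lt_of_lt_of_le (by simp) (le_iSup₂_of_le {x} hS le_rfl)

/-- Branching depth from which `s` successive restrictions to fibers or to children can be made. -/
def branchingBudget (k : ℕ) : ℕ → ℕ
  | 0 => 0
  | s + 1 => k * branchingBudget k s + 1

/-- `L` lists the classes the adversary may have reached, each with the number of mistakes still
owed. One pair `(V, m + 1)` is split at the root instance of its tree into two pairs owing `m`;
every other class passes to a fiber that keeps enough depth. Since `2 ^ (m + 1) - 1 = 2 * (2 ^ m -
1) + 1`, the total falls by at least one per instance. -/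
theorem exists_list_forces [Finite Y] [Nonempty X] [Nonempty Y] :
    ∀ (s : ℕ) (L : List (Set (X → Y) × ℕ)),
      (∀ p ∈ L, Branching (branchingBudget (Nat.card Y) s) p.1) →
      (L.map fun p => 2 ^ p.2 - 1).sum ≤ s →
      ∃ xs : List X, xs.length = s ∧ ∀ p ∈ L, Forces xs p.1 p.2 := by
  intro s
  induction s with
  | zero =>
    intro L hL hs
    refine ⟨[], rfl, fun p hp => ⟨(hL p hp).nonempty, ?_⟩⟩
    have := (List.single_le_sum (by simp) _ (List.mem_map_of_mem hp)).trans hs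
    by_contra h0
    have := Nat.one_lt_two_pow h0
    omega
  | succ s ih =>
    intro L hL hs
    by_cases hz : ∀ p ∈ L, p.2 = 0
    · refine ⟨List.replicate (s + 1) (Classical.arbitrary X), by simp, fun p hp => ?_⟩
      rw [hz p hp]
      exact forces_zero _ (hL p hp).nonempty
    push Not at hz
    obtain ⟨⟨V, m⟩, hp, hm⟩ := hz
    obtain ⟨m, rfl⟩ := Nat.exists_eq_succ_of_ne_zero hm
    obtain ⟨L₁, L₂, rfl⟩ := List.append_of_mem hp
    obtain ⟨x, y₀, y₁, hne, h₀, h₁⟩ := hL _ hp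
    have hk : branchingBudget (Nat.card Y) s ≤ Nat.card Y * branchingBudget (Nat.card Y) s :=
      Nat.le_mul_of_pos_left _ Nat.card_pos
    have hex : ∀ p : Set (X → Y) × ℕ, ∃ y, p ∈ L₁ ++ (V, m.succ) :: L₂ →
        Branching (branchingBudget (Nat.card Y) s) (fiber p.1 x y) := by
      intro p
      by_cases hp : p ∈ L₁ ++ (V, m.succ) :: L₂
      · obtain ⟨y, hy⟩ := Branching.exists_fiber x (hL p hp).pred
        exact ⟨y, fun _ => hy⟩
      · exact ⟨Classical.arbitrary Y, fun h => absurd h hp⟩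
    choose y hy using hex
    obtain ⟨xs, hlen, hxs⟩ := ih ((fiber V x y₀, m) :: (fiber V x y₁, m) ::
        (L₁ ++ L₂).map fun p => (fiber p.1 x (y p), p.2)) (by
      simp only [List.mem_cons, List.mem_map]
      rintro p (rfl | rfl | ⟨q, hq, rfl⟩)
      · exact h₀.of_le hk
      · exact h₁.of_le hk
      · refine hy q ?_
        simp only [List.mem_append, List.mem_cons] at hq ⊢
        tauto) (by
      simp only [List.map_append, List.map_cons, List.sum_append, List.sum_cons, List.map_map,
        Function.comp_def] at hs ⊢
      have : 2 ^ m.succ = 2 ^ m + 2 ^ m := by rw [pow_succ]; ring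
      have : 0 < 2 ^ m := by positivity
      omega)
    refine ⟨x :: xs, by simpa using hlen, fun p hp => ?_⟩
    -- The case split is by value, so any further copy of the split pair is served by the same two
    -- children.
    by_cases hpV : p = (V, m.succ)
    · subst hpV
      intro a
      by_cases ha : a = y₀
      · exact ⟨y₁, Or.inr ⟨ha ▸ hne, m, rfl, hxs (fiber V x y₁, m) (by simp)⟩⟩
      · exact ⟨y₀, Or.inr ⟨ha, m, rfl, hxs (fiber V x y₀, m) (by simp)⟩⟩
    · refine fun _ => ⟨y p, Or.inl (hxs (fiber p.1 x (y p), p.2) ?_)⟩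
      refine List.mem_cons_of_mem _ (List.mem_cons_of_mem _ (List.mem_map_of_mem
        (f := fun p => (fiber p.1 x (y p), p.2)) ?_))
      simp only [List.mem_append, List.mem_cons] at hp ⊢
      tauto

theorem log_le_gameValue [Finite Y] [Nonempty Y] {H : Set (X → Y)} (hH : littlestoneDim H = ⊤)
    {n : ℕ} (hn : 1 ≤ n) : (Nat.log 2 n : ℕ∞) ≤ gameValue H n := by
  have hB := branching_of_littlestoneDim_eq_top hH
  have : Nonempty X := ⟨(hB 1).choose⟩
  have hpow : 2 ^ Nat.log 2 n ≤ n := Nat.pow_log_le_self 2 (by omega)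
  generalize Nat.log 2 n = m at hpow ⊢
  have hsum : ([(H, m)].map fun p : Set (X → Y) × ℕ => 2 ^ p.2 - 1).sum ≤ n := by
    rw [List.map_singleton, List.sum_singleton]
    exact (Nat.sub_le _ _).trans hpow
  have hall : ∀ p ∈ [(H, m)], Branching (branchingBudget (Nat.card Y) n) p.1 := by
    intro p hp
    rw [List.mem_singleton.mp hp]
    exact hB _
  obtain ⟨xs, hlen, hxs⟩ := exists_list_forces n _ hall hsum
  rw [← hlen]
  exact (hxs (H, m) (List.mem_singleton_self _)).le_gameValue

/-! ### Strategies from potentials -/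

/-- The functions of `H` consistent with the first `t` labels of `h`. -/
def versionSpace (H : Set (X → Y)) {n : ℕ} (x : Fin n → X) (h : X → Y) (t : ℕ) : Set (X → Y) :=
  {g ∈ H | ∀ i : Fin n, (i : ℕ) < t → g (x i) = h (x i)}

theorem versionSpace_succ (H : Set (X → Y)) {n : ℕ} (x : Fin n → X) (h : X → Y) (t : Fin n) :
    versionSpace H x h (t + 1) = fiber (versionSpace H x h t) (x t) (h (x t)) := by
  ext g
  constructor
  · exact fun hg => ⟨⟨hg.1, fun i hi => hg.2 i (by omega)⟩, hg.2 t (by omega)⟩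
  · rintro ⟨hg, hgt⟩
    refine ⟨hg.1, fun i hi => ?_⟩
    rcases Nat.lt_succ_iff_lt_or_eq.mp hi with hi | hi
    · exact hg.2 i hi
    · rwa [Fin.ext hi]

/-- The potential may depend on the whole sequence `x`, which is where advance knowledge of the
instances enters. Only nonempty fibers matter, because the true function always survives. -/
theorem gameValue_le_of_potential [Nonempty Y] {H : Set (X → Y)} {n M : ℕ}
    (hΦ : ∀ x : Fin n → X, ∃ Φ : Set (X → Y) → ℕ, Φ H ≤ M ∧
      (∀ V W, V ⊆ W → W ⊆ H → Φ V ≤ Φ W) ∧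
      ∀ V ⊆ H, ∀ t, ∀ y y', y ≠ y' → (fiber V (x t) y).Nonempty → (fiber V (x t) y').Nonempty →
        Φ (fiber V (x t) y) = Φ V → Φ (fiber V (x t) y') = Φ V → False) :
    gameValue H n ≤ M := by
  classical
  choose Φ hΦM hmono hsplit using hΦ
  have hpred : ∀ (x : Fin n → X) (V : Set (X → Y)) (t : Fin n), ∃ p : Y, V ⊆ H →
      ∀ y, p ≠ y → (fiber V (x t) y).Nonempty → Φ x (fiber V (x t) y) < Φ x V := by
    intro x V t
    by_cases hex : ∃ p, (fiber V (x t) p).Nonempty ∧ Φ x (fiber V (x t) p) = Φ x V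
    · obtain ⟨p, hp, hpΦ⟩ := hex
      refine ⟨p, fun hV y hy hne => lt_of_le_of_ne (hmono x _ _ (fiber_subset _ _ _) hV) ?_⟩
      exact fun he => hsplit x V hV t p y hy hp hne hpΦ he
    · push Not at hex
      exact ⟨Classical.arbitrary Y, fun hV y _ hne =>
        lt_of_le_of_ne (hmono x _ _ (fiber_subset _ _ _) hV) (hex y hne)⟩
  choose pr hpr using hpred
  let A : Strategy X Y n := fun x t l =>
    pr x {g ∈ H | ∀ i : Fin t, g (x ⟨i, i.isLt.trans t.isLt⟩) = l i} t
  have hA : ∀ x h t, A.prediction x h t = pr x (versionSpace H x h t) t := by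
    intro x h t
    simp only [Strategy.prediction, A]
    congr 1
    ext g
    simp only [versionSpace, Set.mem_ofPred_eq]
    exact and_congr_right fun _ =>
      ⟨fun hg i hi => hg ⟨i, hi⟩, fun hg i => hg ⟨i, i.isLt.trans t.isLt⟩ i.isLt⟩
  refine (iInf_le _ A).trans (iSup_le fun x => iSup₂_le fun h hh => ?_)
  -- Invariant: the remaining potential plus the mistakes made so far never exceeds the initial
  -- potential.
  have key : ∀ t ≤ n, Φ x (versionSpace H x h t) +
      #{i : Fin n | (i : ℕ) < t ∧ A.prediction x h i ≠ h (x i)} ≤ Φ x H := by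
    intro t
    induction t with
    | zero =>
      intro _
      simpa using hmono x _ _ (fun g hg => hg.1) le_rfl
    | succ t ih =>
      intro ht
      have ih := ih (by omega)
      have hsub : versionSpace H x h t ⊆ H := fun g hg => hg.1
      have hfib := versionSpace_succ H x h ⟨t, ht⟩
      simp only at hfib
      have hne : (versionSpace H x h (t + 1)).Nonempty := ⟨h, hh, fun _ _ => rfl⟩
      rw [hfib] at hne ⊢
      by_cases hp : A.prediction x h ⟨t, ht⟩ = h (x ⟨t, ht⟩)
      · have hset : ({i : Fin n | (i : ℕ) < t + 1 ∧ A.prediction x h i ≠ h (x i)} : Finset _) ⊆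
            ({i : Fin n | (i : ℕ) < t ∧ A.prediction x h i ≠ h (x i)} : Finset _) := by
          intro i
          simp only [mem_filter, mem_univ, true_and]
          rintro ⟨hi, hne⟩
          refine ⟨?_, hne⟩
          rcases Nat.lt_succ_iff_lt_or_eq.mp hi with hi | hi
          · exact hi
          · obtain rfl : i = ⟨t, ht⟩ := Fin.ext hi
            exact absurd hp hne
        have := card_le_card hset
        have := hmono x _ _ (fiber_subset (versionSpace H x h t) (x ⟨t, ht⟩) (h (x ⟨t, ht⟩))) hsub
        omega
      · have hset : ({i : Fin n | (i : ℕ) < t + 1 ∧ A.prediction x h i ≠ h (x i)} : Finset _) ⊆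
            insert ⟨t, ht⟩ ({i : Fin n | (i : ℕ) < t ∧ A.prediction x h i ≠ h (x i)} : Finset _) := by
          intro i
          simp only [mem_insert, mem_filter, mem_univ, true_and]
          rintro ⟨hi, hne⟩
          rcases Nat.lt_succ_iff_lt_or_eq.mp hi with hi | hi
          · exact Or.inr ⟨hi, hne⟩
          · exact Or.inl (Fin.ext hi)
        have := (card_le_card hset).trans (card_insert_le _ _)
        rw [hA] at hp
        have := hpr x _ ⟨t, ht⟩ hsub _ hp hne
        omega
  have hn := key n le_rfl
  have hM := hΦM x
  rw [Strategy.mistakes, Set.ncard_eq_toFinset_card']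
  simp only [Fin.is_lt, true_and] at hn
  have : #{i : Fin n | A.prediction x h i ≠ h (x i)} ≤ M := by omega
  simpa using this

theorem gameValue_le_length [Nonempty Y] (H : Set (X → Y)) (n : ℕ) : gameValue H n ≤ n := by
  refine (iInf_le _ fun _ _ _ => Classical.arbitrary Y).trans
    (iSup_le fun x => iSup₂_le fun h _ => ?_)
  exact_mod_cast (Set.ncard_le_card _).trans_eq (by simp)

/-- The standard optimal algorithm: if two fibers at one instance were as deep as `V`, joining them
there would give a deeper tree for `V`. -/
theorem gameValue_le_of_not_branching [Nonempty Y] {H : Set (X → Y)} {B : ℕ}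
    (hB : ∀ m, Branching m H → m ≤ B) (n : ℕ) : gameValue H n ≤ B := by
  classical
  refine gameValue_le_of_potential fun x =>
    ⟨fun V => Nat.findGreatest (fun m => Branching m V) B, Nat.findGreatest_le _, ?_, ?_⟩
  · exact fun V W hVW _ => Nat.findGreatest_mono_left (fun m hm => hm.mono hVW) B
  · intro V hV t y y' hy hne hne' he he'
    -- `Nat.findGreatest` also returns `0` when no depth works, so nonemptiness is needed to realize
    -- its value.
    have h₀ := Nat.findGreatest_spec (P := fun m => Branching m (fiber V (x t) y)) (Nat.zero_le B) hne
    have h₁ := Nat.findGreatest_spec (P := fun m => Branching m (fiber V (x t) y')) (Nat.zero_le B)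
      hne'
    simp only at he he'
    rw [he] at h₀
    rw [he'] at h₁
    have hbr : Branching (Nat.findGreatest (fun m => Branching m V) B + 1) V :=
      ⟨x t, y, y', hy, h₀, h₁⟩
    have := Nat.le_findGreatest (P := fun m => Branching m V) (hB _ (hbr.mono hV)) hbr
    omega

theorem exists_gameValue_le_of_littlestoneDim_lt_top [Nonempty Y] {H : Set (X → Y)}
    (hH : littlestoneDim H < ⊤) : ∃ B : ℕ, ∀ n : ℕ, gameValue H n ≤ B := by
  obtain ⟨D, hD⟩ := ENat.ne_top_iff_exists.mp hH.ne
  refine ⟨D + 1, gameValue_le_of_not_branching fun m hm => ?_⟩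
  rcases m with _ | m
  · omega
  · have := hm.le_littlestoneDim
    rw [← hD] at this
    exact Nat.succ_le_succ (by exact_mod_cast this)

/-! ### The Sauer–Natarajan bound and the halving strategy -/

/-- The bound of the Sauer–Natarajan lemma for `t` instances and shattered sets of size `< D`. -/
def sauerSum (B t D : ℕ) : ℕ := ∑ i ∈ range D, t.choose i * B ^ i

theorem sauerSum_succ (B t D : ℕ) :
    sauerSum B (t + 1) (D + 1) = sauerSum B t (D + 1) + B * sauerSum B t D := by
  simp only [sauerSum]
  rw [sum_range_succ', sum_range_succ' _ D, mul_sum]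
  simp only [Nat.choose_succ_succ, add_mul, sum_add_distrib, Nat.choose_zero_right]
  have : ∀ i, B * (t.choose i * B ^ i) = t.choose i * B ^ (i + 1) := fun i => by ring
  simp only [this]
  ring

theorem sauerSum_mono (B : ℕ) {t t' : ℕ} (h : t ≤ t') (D : ℕ) : sauerSum B t D ≤ sauerSum B t' D :=
  sum_le_sum fun _ _ => Nat.mul_le_mul_right _ (Nat.choose_le_choose _ h)

-- Functions are grouped by their values off `a`. A group of size `l ≥ 1` counts once in the image
-- and `l * (l - 1)` times among ordered pairs of distinct labels, and `l ≤ 1 + l * (l - 1)`.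
open Classical in
theorem card_le_image_update_add [Fintype Y] (V : Finset (X → Y)) (a : X) (y₀ : Y) :
    V.card ≤ (V.image fun h => Function.update h a y₀).card +
      ∑ q ∈ (univ : Finset Y).offDiag, #{g ∈ V.image fun h => Function.update h a y₀ |
        Function.update g a q.1 ∈ V ∧ Function.update g a q.2 ∈ V} := by
  rw [card_eq_sum_card_image (fun h => Function.update h a y₀) V]
  simp only [card_filter _ (Finset.image _ _)]
  rw [sum_comm (s := univ.offDiag), card_eq_sum_ones, ← sum_add_distrib]
  refine sum_le_sum fun g hg => ?_
  set L : Finset Y := {b | Function.update g a b ∈ V} with hL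
  have h₁ : #{h ∈ V | Function.update h a y₀ = g} ≤ #L := by
    refine card_le_card_of_injOn (fun h => h a) ?_ ?_
    · intro h hh
      obtain ⟨hV, rfl⟩ := mem_filter.mp hh
      simpa [hL] using hV
    · intro h hh h' hh' he
      have e := (mem_filter.mp hh).2.trans (mem_filter.mp hh').2.symm
      funext z
      by_cases hz : z = a
      · exact hz ▸ he
      · simpa [hz] using congrFun e z
  have h₂ : ∑ q ∈ (univ : Finset Y).offDiag,
      (if Function.update g a q.1 ∈ V ∧ Function.update g a q.2 ∈ V then 1 else 0) =
        #L * #L - #L := by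
    rw [← offDiag_card, ← card_filter]
    congr 1
    ext q
    simp only [hL, mem_filter, mem_offDiag, mem_univ, true_and]
    tauto
  rw [h₂]
  refine h₁.trans ?_
  rcases Nat.lt_or_ge (#L) 2 with h | h
  · omega
  · have : 2 * #L ≤ #L * #L := Nat.mul_le_mul_right _ h
    omega

theorem NatarajanShatters.of_image_update [Nonempty Y] [DecidableEq X] {V : Set (X → Y)}
    {S : Finset X} {a : X} {y₀ : Y}
    (hS : NatarajanShatters ((fun h => Function.update h a y₀) '' V) S) :
    NatarajanShatters V S := by
  have ha : a ∉ S := by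
    intro ha
    obtain ⟨_, ⟨g, -, rfl⟩, _, ⟨h, -, rfl⟩, hne⟩ := hS.exists_ne ha
    simp at hne
  obtain ⟨f₀, f₁, hne, hA⟩ := hS.exists_total
  refine .of_total f₀ f₁ hne fun A hAS => ?_
  obtain ⟨_, ⟨h, hh, rfl⟩, hx⟩ := hA A hAS
  refine ⟨h, hh, fun x hxS => ?_⟩
  have hxa : x ≠ a := fun e => ha (e ▸ hxS)
  simpa [hxa] using hx x hxS

theorem NatarajanShatters.insert_of_update [Nonempty Y] [DecidableEq X] {V W : Set (X → Y)}
    {S : Finset X} {a : X} {b c : Y} (ha : a ∉ S) (hbc : b ≠ c) (hS : NatarajanShatters W S)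
    (hW : ∀ g ∈ W, Function.update g a b ∈ V ∧ Function.update g a c ∈ V) :
    NatarajanShatters V (insert a S) := by
  obtain ⟨f₀, f₁, hne, hA⟩ := hS.exists_total
  have hxa : ∀ x ∈ S, x ≠ a := fun x hx e => ha (e ▸ hx)
  refine .of_total (Function.update f₀ a b) (Function.update f₁ a c) ?_ ?_
  · intro x hx
    rcases mem_insert.mp hx with rfl | hx
    · simpa using hbc
    · simpa [hxa x hx] using hne x hx
  · intro A hAS
    obtain ⟨g, hg, hgx⟩ := hA (A.erase a) (fun x hx =>
      (mem_insert.mp (hAS (mem_of_mem_erase hx))).resolve_left (ne_of_mem_erase hx))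
    by_cases haA : a ∈ A
    · refine ⟨_, (hW g hg).2, fun x hx => ?_⟩
      rcases mem_insert.mp hx with rfl | hx
      · simp [haA]
      · simpa [hxa x hx] using hgx x hx
    · refine ⟨_, (hW g hg).1, fun x hx => ?_⟩
      rcases mem_insert.mp hx with rfl | hx
      · simp [haA]
      · simpa [hxa x hx] using hgx x hx

/-- Erasing the value at `a` creates no new shattered set. For each pair of distinct labels, the
functions extendable by both shatter only sets to which `a` can be added, so their bound drops from
`D + 1` to `D`. At most `k * k` such pairs give the recursion `sauerSum_succ`. -/
theorem card_le_sauerSum [Fintype Y] (y₀ : Y) (T : Finset X) :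
    ∀ (V : Finset (X → Y)) (D : ℕ), (∀ h ∈ V, ∀ x ∉ T, h x = y₀) →
      (∀ S, NatarajanShatters (V : Set (X → Y)) S → S.card < D) →
      V.card ≤ sauerSum (Fintype.card Y * Fintype.card Y) T.card D := by
  classical
  have : Nonempty Y := ⟨y₀⟩
  induction T using Finset.induction_on with
  | empty =>
    intro V D hV hD
    rcases V.eq_empty_or_nonempty with rfl | hne
    · simp
    -- A nonempty class shatters `∅`, which forces `D` to be positive.
    · have hD0 := hD ∅ (natarajanShatters_empty (by simpa using hne))
      obtain ⟨D, rfl⟩ := Nat.exists_eq_succ_of_ne_zero (by simpa using hD0.ne')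
      refine (card_le_one.mpr fun g hg h hh => ?_).trans ?_
      · funext x
        rw [hV g hg x (by simp), hV h hh x (by simp)]
      · rw [sauerSum, sum_range_succ']
        simp
  | insert a T ha ih =>
    intro V D hV hD
    rcases V.eq_empty_or_nonempty with rfl | hne
    · simp
    have hD0 := hD ∅ (natarajanShatters_empty (by simpa using hne))
    obtain ⟨D, rfl⟩ := Nat.exists_eq_succ_of_ne_zero (by simpa using hD0.ne')
    have hsupp : ∀ g ∈ V.image fun h => Function.update h a y₀, ∀ x ∉ T, g x = y₀ := by
      intro g hg x hx
      obtain ⟨h, hh, rfl⟩ := mem_image.mp hg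
      by_cases hxa : x = a
      · simp [hxa]
      · simpa [hxa] using hV h hh x (by simp [hxa, hx])
    rw [card_insert_of_notMem ha, Nat.succ_eq_add_one, sauerSum_succ]
    refine (card_le_image_update_add V a y₀).trans (add_le_add ?_ ?_)
    · refine ih _ _ hsupp fun S hS => hD S ?_
      rw [coe_image] at hS
      exact hS.of_image_update
    · refine (sum_le_card_nsmul _ _ (sauerSum (Fintype.card Y * Fintype.card Y) T.card D) ?_).trans ?_
      · rintro ⟨b, c⟩ hq
        have hbc : b ≠ c := (mem_offDiag.mp hq).2.2
        refine ih _ _ (fun g hg => hsupp g (mem_filter.mp hg).1) fun S hS => ?_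
        have haS : a ∉ S := by
          intro haS
          obtain ⟨g, hg, h, hh, hne⟩ := hS.exists_ne haS
          exact hne ((hsupp g (mem_filter.mp hg).1 a ha).trans
            (hsupp h (mem_filter.mp hh).1 a ha).symm)
        have := hD _ (hS.insert_of_update haS hbc fun g hg => (mem_filter.mp hg).2)
        rw [card_insert_of_notMem haS] at this
        omega
      · rw [smul_eq_mul, offDiag_card, card_univ]
        exact Nat.mul_le_mul_right _ (Nat.sub_le _ _)

open Classical in
/-- The function that agrees with `h` on `T` and equals `y₀` elsewhere. -/
noncomputable def truncate (T : Finset X) (y₀ : Y) (h : X → Y) : X → Y :=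
  fun x => if x ∈ T then h x else y₀

theorem finite_image_truncate [Finite Y] (T : Finset X) (y₀ : Y) (V : Set (X → Y)) :
    (truncate T y₀ '' V).Finite := by
  classical
  refine (Set.finite_range fun f : T → Y => fun x => if hx : x ∈ T then f ⟨x, hx⟩ else y₀).subset ?_
  rintro _ ⟨h, -, rfl⟩
  refine ⟨fun x => h x, ?_⟩
  funext x
  by_cases hx : x ∈ T <;> simp [truncate, hx]

theorem NatarajanShatters.of_image_truncate [Nonempty Y] {T : Finset X} {y₀ : Y} {V : Set (X → Y)}
    {S : Finset X} (hS : NatarajanShatters (truncate T y₀ '' V) S) : NatarajanShatters V S := by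
  classical
  have hST : ∀ x ∈ S, x ∈ T := by
    intro x hx
    by_contra hxT
    obtain ⟨_, ⟨g, -, rfl⟩, _, ⟨h, -, rfl⟩, hne⟩ := hS.exists_ne hx
    simp [truncate, hxT] at hne
  obtain ⟨f₀, f₁, hne, hA⟩ := hS.exists_total
  refine .of_total f₀ f₁ hne fun A hAS => ?_
  obtain ⟨_, ⟨h, hh, rfl⟩, hx⟩ := hA A hAS
  refine ⟨h, hh, fun x hxS => ?_⟩
  simpa [truncate, hST x hxS] using hx x hxS

/-- Halving: restrictions from different fibers are disjoint, so two fibers with the same integer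
logarithm `e` as `V` would give `V` at least `2 ^ (e + 1)` restrictions. -/
theorem gameValue_le_log_sauerSum [Finite Y] [Nonempty Y] {H : Set (X → Y)} {d : ℕ}
    (hd : natarajanDim H = d) (n : ℕ) :
    gameValue H n ≤ Nat.log 2 (sauerSum (Nat.card Y * Nat.card Y) n (d + 1)) := by
  classical
  have := Fintype.ofFinite Y
  obtain ⟨y₀⟩ := ‹Nonempty Y›
  have : Nonempty Y := ⟨y₀⟩
  refine gameValue_le_of_potential fun x => ?_
  set T := univ.image x with hT
  have hfin := finite_image_truncate T y₀
  refine ⟨fun V => Nat.log 2 (truncate T y₀ '' V).ncard, Nat.log_mono_right ?_, ?_, ?_⟩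
  · rw [Set.ncard_eq_toFinset_card _ (hfin H), Nat.card_eq_fintype_card]
    refine (card_le_sauerSum y₀ T _ (d + 1) ?_ ?_).trans
      (sauerSum_mono _ (card_image_le.trans_eq (by simp)) _)
    · intro h hh z hz
      obtain ⟨g, -, rfl⟩ := (hfin H).mem_toFinset.mp hh
      simp [truncate, hz]
    · intro S hS
      rw [Set.Finite.coe_toFinset] at hS
      have hle : (S.card : ℕ∞) ≤ natarajanDim H := le_iSup₂_of_le S hS.of_image_truncate le_rfl
      rw [hd] at hle
      exact Nat.lt_succ_of_le (by exact_mod_cast hle)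
  · exact fun V W hVW _ => Nat.log_mono_right (Set.ncard_le_ncard (Set.image_mono hVW) (hfin W))
  · intro V _ t y y' hy hne hne' he he'
    simp only at he he'
    have hpos : ∀ {W : Set (X → Y)}, W.Nonempty → (truncate T y₀ '' W).ncard ≠ 0 :=
      fun {W} hW => ((Set.ncard_pos (hfin W)).mpr (hW.image _)).ne'
    have h₀ := Nat.pow_log_le_self 2 (hpos hne)
    have h₁ := Nat.pow_log_le_self 2 (hpos hne')
    rw [he] at h₀
    rw [he'] at h₁
    have hdisj : Disjoint (truncate T y₀ '' fiber V (x t) y) (truncate T y₀ '' fiber V (x t) y') := by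
      rw [Set.disjoint_left]
      rintro _ ⟨g, hg, rfl⟩ ⟨h, hh, he⟩
      have hxT : x t ∈ T := by simp [hT]
      have := congrFun he (x t)
      simp only [truncate, hxT, if_true] at this
      exact hy (hg.2.symm.trans (this.symm.trans hh.2))
    have hu := Set.ncard_union_eq hdisj (hfin _) (hfin _)
    have hle : (truncate T y₀ '' fiber V (x t) y ∪ truncate T y₀ '' fiber V (x t) y').ncard ≤
        (truncate T y₀ '' V).ncard :=
      Set.ncard_le_ncard (Set.union_subset (Set.image_mono (fiber_subset _ _ _))
        (Set.image_mono (fiber_subset _ _ _))) (hfin V)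
    have := Nat.lt_pow_succ_log_self (b := 2) (by norm_num) (truncate T y₀ '' V).ncard
    rw [pow_succ] at this
    omega

/-! ### Closed form of the Sauer–Natarajan bound -/

theorem sauerSum_le_pow {B n d : ℕ} (hd : 1 ≤ d) (hdn : d ≤ n) (hB : 1 ≤ B) :
    (sauerSum B n (d + 1) : ℝ) ≤ (Real.exp 1 * (n * B / d)) ^ d := by
  have hd0 : (0 : ℝ) < d := by exact_mod_cast hd
  have hn0 : (0 : ℝ) < n := hd0.trans_le (by exact_mod_cast hdn)
  have hB1 : (1 : ℝ) ≤ B := by exact_mod_cast hB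
  have hr : 1 ≤ (n : ℝ) / d := by
    rw [one_le_div hd0]
    exact_mod_cast hdn
  -- As `n * B / d ≥ 1`, its power `i ≤ d` may be raised to `d`. The leftover weights `(d / n) ^ i`
  -- then sum, over all `i ≤ n`, to `(1 + d / n) ^ n ≤ e ^ d`.
  have hterm : ∀ i ∈ range (d + 1), ((n.choose i * B ^ i : ℕ) : ℝ) ≤
      (n * B / d : ℝ) ^ d * (n.choose i * (d / n : ℝ) ^ i) := by
    intro i hi
    have hid : i ≤ d := Nat.lt_succ_iff.mp (mem_range.mp hi)
    have h₁ : (B : ℝ) ^ i ≤ (n * B / d : ℝ) ^ d * (d / n : ℝ) ^ i := by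
      calc (B : ℝ) ^ i = (n * B / d : ℝ) ^ i * (d / n : ℝ) ^ i := by
            rw [← mul_pow]
            congr 1
            field_simp
        _ ≤ _ := by
            refine mul_le_mul_of_nonneg_right (pow_le_pow_right₀ ?_ hid) (by positivity)
            rw [mul_div_right_comm]
            exact one_le_mul_of_one_le_of_one_le hr hB1
    push_cast
    calc (n.choose i : ℝ) * (B : ℝ) ^ i ≤ n.choose i * ((n * B / d : ℝ) ^ d * (d / n : ℝ) ^ i) :=
          mul_le_mul_of_nonneg_left h₁ (by positivity)
      _ = _ := by ring
  calc (sauerSum B n (d + 1) : ℝ) = ∑ i ∈ range (d + 1), ((n.choose i * B ^ i : ℕ) : ℝ) := by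
        rw [sauerSum, Nat.cast_sum]
    _ ≤ ∑ i ∈ range (d + 1), (n * B / d : ℝ) ^ d * (n.choose i * (d / n : ℝ) ^ i) :=
        sum_le_sum hterm
    _ ≤ ∑ i ∈ range (n + 1), (n * B / d : ℝ) ^ d * (n.choose i * (d / n : ℝ) ^ i) :=
        sum_le_sum_of_subset_of_nonneg (range_mono (by omega)) fun _ _ _ => by positivity
    _ = (n * B / d : ℝ) ^ d * (d / n + 1 : ℝ) ^ n := by
        rw [← mul_sum, add_pow]
        congr 1
        exact sum_congr rfl fun i _ => by ring
    _ ≤ (n * B / d : ℝ) ^ d * Real.exp 1 ^ d := by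
        refine mul_le_mul_of_nonneg_left ?_ (by positivity)
        calc (d / n + 1 : ℝ) ^ n ≤ Real.exp (d / n) ^ n :=
              pow_le_pow_left₀ (by positivity) (Real.add_one_le_exp _) n
          _ = Real.exp 1 ^ d := by
              rw [← Real.exp_nat_mul, ← Real.exp_nat_mul]
              congr 1
              field_simp
    _ = _ := by rw [mul_pow, mul_comm]

theorem log_sauerSum_le {n d k : ℕ} (hd : 1 ≤ d) (hdn : d ≤ n) (hk : 2 ≤ k) :
    (Nat.log 2 (sauerSum (k * k) n (d + 1)) : ℝ) ≤ 4 * (d * Real.logb 2 (n * k / d)) := by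
  have hd0 : (0 : ℝ) < d := by exact_mod_cast hd
  have hk2 : (2 : ℝ) ≤ k := by exact_mod_cast hk
  have hr : 1 ≤ (n : ℝ) / d := by
    rw [one_le_div hd0]
    exact_mod_cast hdn
  set z : ℝ := n * k / d with hz
  have hkz : (k : ℝ) ≤ z := by
    rw [hz, mul_div_right_comm]
    exact le_mul_of_one_le_left (by linarith) hr
  have hz2 : 2 ≤ z := hk2.trans hkz
  -- The left side is `e * z * k`, with `k ≤ z` and `e < 4 ≤ z * z`; the exponent `4` becomes the
  -- universal constant.
  have hbase : Real.exp 1 * (n * ((k * k : ℕ) : ℝ) / d) ≤ z ^ 4 := by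
    have he : Real.exp 1 ≤ z * z := by
      have := Real.exp_one_lt_d9
      nlinarith
    have : (n * ((k * k : ℕ) : ℝ) / d) = z * k := by
      rw [hz]
      push_cast
      ring
    rw [this]
    calc Real.exp 1 * (z * k) ≤ (z * z) * (z * z) := by gcongr
      _ = z ^ 4 := by ring
  have hle : (sauerSum (k * k) n (d + 1) : ℝ) ≤ (z ^ 4) ^ d :=
    (sauerSum_le_pow hd hdn (by nlinarith)).trans (pow_le_pow_left₀ (by positivity) hbase d)
  have hpos : 0 < sauerSum (k * k) n (d + 1) := by
    rw [sauerSum, sum_range_succ']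
    simp
  calc (Nat.log 2 (sauerSum (k * k) n (d + 1)) : ℝ)
      ≤ Real.logb 2 (sauerSum (k * k) n (d + 1)) := by
        exact_mod_cast Real.natLog_le_logb (sauerSum (k * k) n (d + 1)) 2
    _ ≤ Real.logb 2 ((z ^ 4) ^ d) :=
        Real.logb_le_logb_of_le (by norm_num) (by exact_mod_cast hpos) hle
    _ = 4 * (d * Real.logb 2 z) := by
        rw [Real.logb_pow, Real.logb_pow]
        push_cast
        ring

theorem gameValue_le_mul_logb [Finite Y] [Nonempty Y] {H : Set (X → Y)} {d n : ℕ}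
    (hd : natarajanDim H = d) (hd1 : 1 ≤ d) (hk : 2 ≤ Nat.card Y) (hn : 2 * d ≤ n * Nat.card Y) :
    (gameValue H n : ENNReal) ≤
      ENNReal.ofReal (4 * ((d : ℝ) * Real.logb 2 ((n : ℝ) * (Nat.card Y : ℝ) / (d : ℝ)))) := by
  suffices h : ∃ M : ℕ, gameValue H n ≤ M ∧
      (M : ℝ) ≤ 4 * ((d : ℝ) * Real.logb 2 ((n : ℝ) * (Nat.card Y : ℝ) / (d : ℝ))) by
    obtain ⟨M, hM, hle⟩ := h
    calc (gameValue H n : ENNReal) ≤ ((M : ℕ∞) : ENNReal) := ENat.toENNReal_le.mpr hM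
      _ = ENNReal.ofReal M := by simp
      _ ≤ _ := ENNReal.ofReal_le_ofReal hle
  rcases le_or_gt d n with hdn | hdn
  · exact ⟨_, gameValue_le_log_sauerSum hd n, log_sauerSum_le hd1 hdn hk⟩
  -- Here `n < d`, and `n * k / d ≥ 2` makes the logarithm at least `1`, so the trivial bound is
  -- enough.
  · refine ⟨n, gameValue_le_length H n, ?_⟩
    have hd0 : (0 : ℝ) < d := by exact_mod_cast hd1
    have hz : (2 : ℝ) ≤ n * Nat.card Y / d := by
      rw [le_div_iff₀ hd0]
      exact_mod_cast hn
    have hlog : 1 ≤ Real.logb 2 ((n : ℝ) * Nat.card Y / d) := by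
      rw [Real.le_logb_iff_rpow_le (by norm_num) (by linarith)]
      simpa using hz
    have hnd : (n : ℝ) ≤ d := by exact_mod_cast hdn.le
    nlinarith

end

end TransductiveOnline

theorem mainTheorem4 :
    ∃ C : ℝ, 0 < C ∧
      ∀ (X : Type*) (Y : Type*) [Finite Y] [Nonempty Y] (H : Set (X → Y)),
        (TransductiveOnline.natarajanDim H = ⊤ →
          ∀ n : ℕ, (n : ℕ∞) ≤ ENat.card X → TransductiveOnline.gameValue H n = n) ∧
        (∀ d : ℕ, TransductiveOnline.natarajanDim H = d → TransductiveOnline.littlestoneDim H = ⊤ →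
          ∀ n : ℕ, 1 ≤ n → (n : ℕ∞) ≤ ENat.card X →
            ((max (min d n) (Nat.log 2 n) : ℕ) : ℕ∞) ≤ TransductiveOnline.gameValue H n ∧
            (2 * d ≤ n * Nat.card Y →
              (TransductiveOnline.gameValue H n : ENNReal) ≤
                ENNReal.ofReal
                  (C * ((d : ℝ) * Real.logb 2 ((n : ℝ) * (Nat.card Y : ℝ) / (d : ℝ)))))) ∧
        (TransductiveOnline.littlestoneDim H < ⊤ →
          ∃ B : ℕ, ∀ n : ℕ, (n : ℕ∞) ≤ ENat.card X → TransductiveOnline.gameValue H n ≤ B) := by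
  open TransductiveOnline in
  refine ⟨4, by norm_num, fun X Y _ _ H => ⟨fun hND n _ => ?_, fun d hd hLD n hn _ => ⟨?_, ?_⟩,
    fun hLD => ?_⟩⟩
  · exact le_antisymm (gameValue_le_length H n)
      (le_gameValue_of_le_natarajanDim (hND ▸ le_top) le_rfl)
  · rcases max_choice (min d n) (Nat.log 2 n) with h | h <;> rw [h]
    · exact le_gameValue_of_le_natarajanDim (by rw [hd]; exact_mod_cast min_le_left d n)
        (min_le_right d n)
    · exact log_le_gameValue hLD hn
  -- A single branching node already gives `d ≥ 1` and two distinct labels, hence `k ≥ 2`.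
  · have hB := branching_of_littlestoneDim_eq_top hLD 1
    have hd1 := natarajanDim_pos_of_branching hB
    rw [hd] at hd1
    obtain ⟨_, y₀, y₁, hne, -⟩ := hB
    have : Nontrivial Y := ⟨y₀, y₁, hne⟩
    exact gameValue_le_mul_logb hd (by exact_mod_cast hd1) Finite.one_lt_card
  · obtain ⟨B, hB⟩ := exists_gameValue_le_of_littlestoneDim_lt_top hLD
    exact ⟨B, fun n _ => hB n⟩
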